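/- All rings are commutative with unity. A (commutative, one-dimensional) formal group $F(u,v)=u+v+\sum_{i,j\ge 1}a_{i,j}u^iv^j$ over a ring $R$ is called generating if $R$ coincides with its ring of coefficients $R_F$, i.e. with the subring of $R$ generated by all $a_{i,j}$, $i,j\ge 1$. Let $A(u)=1+A_1u+\sum_{k\ge 3}A_ku^k$ and $B(u)=1+\sum_{k\ge 2}B_ku^k$ (so $A_2=B_1=0$), where the $A_k$, $B_k$ are independent indeterminates, and let $$F(u,v)=\frac{u^2A(v)-v^2A(u)}{uB(v)-vB(u)},$$ a power series in $u,v$ over $\mathbb{Z}[A_1,A_3,A_4,\ldots,B_2,B_3,\ldots]$. (1) Let $R_5=\mathbb{Z}[a_1,b_1,b_2,A_1,A_3,A_4,\ldots,B_2,B_3,B_4,\ldots]/(I_{ass}+I_5)$, where $a_1,b_1,b_2$ are further independent indeterminates, $I_{ass}$ is the ideal generated by all coefficients of $F(u,F(v,w))-F(F(u,v),w)$, and $I_5$ is the ideal generated by all coefficients of the relation $$(B(u)+b_1u)^2(B(u)+b_2u)=A(u)^2(A(u)+a_1u^2)^2,$$ that is, of the difference of its two sides. Then the formal group over $R_5$ given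 by the image of $F$ is not generating over $R_5$. (2) Let $R_6=\mathbb{Z}[a_1,a_2,b_1,b_2,A_1,A_3,A_4,\ldots,B_2,B_3,B_4,\ldots]/(I_{ass}+I_6)$, where $a_1,a_2,b_1,b_2$ are further independent indeterminates, $I_{ass}$ is again the ideal generated by all coefficients of $F(u,F(v,w))-F(F(u,v),w)$, and $I_6$ is the ideal generated by all coefficients of the relation $$(B(u)+b_1u)^2(B(u)+b_2u)^2=A(u)^2(A(u)+a_1u^2)^2(A(u)+a_2u^2).$$ Then the formal group over $R_6$ given by the image of $F$ is not generating over $R_6$. -/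

import Mathlib

noncomputable section

namespace BuchstaberFG

open MvPowerSeries Finsupp

section Quotient

variable {R : Type*} [CommRing R]

/-- The series `f(u) ∈ R⟦u, v⟧` for `f ∈ R⟦X⟧`; the variables `u`, `v` have the indices `0`, `1`. -/
def atU (f : PowerSeries R) : MvPowerSeries (Fin 2) R := f.subst (X 0 : MvPowerSeries (Fin 2) R)

/-- The series `f(v) ∈ R⟦u, v⟧` for `f ∈ R⟦X⟧`. -/
def atV (f : PowerSeries R) : MvPowerSeries (Fin 2) R := f.subst (X 1 : MvPowerSeries (Fin 2) R)

/-- The divided difference `(f(u) - f(v)) / (u - v) = ∑ f_{i+j+1} u^i v^j`. -/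
def divDiff (f : PowerSeries R) : MvPowerSeries (Fin 2) R :=
  fun e => PowerSeries.coeff (e 0 + e 1 + 1) f

/-- The series `(u² A(v) - v² A(u)) / (u - v)`. -/
def numQuot (A : PowerSeries R) : MvPowerSeries (Fin 2) R :=
  (X 0 + X 1) * atV A - X 1 ^ 2 * divDiff A

/-- The series `(u B(v) - v B(u)) / (u - v)`; its constant term is `1` when `B(0) = 1`. -/
def denQuot (B : PowerSeries R) : MvPowerSeries (Fin 2) R :=
  atV B - X 1 * divDiff B

/-- The series `(u² A(v) - v² A(u)) / (u B(v) - v B(u))`, for `B(0) = 1`: numerator and denominator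
are both divided by `u - v`, after which the denominator is invertible. That this is indeed the
quotient is `mul_buchstaberSeries`. -/
def buchstaberSeries (A B : PowerSeries R) : MvPowerSeries (Fin 2) R :=
  numQuot A * invOfUnit (denQuot B) 1

theorem constantCoeff_atV (f : PowerSeries R) :
    constantCoeff (atV f) = PowerSeries.constantCoeff f := by
  rw [← coeff_zero_eq_constantCoeff_apply, atV, PowerSeries.coeff_subst_single]
  simp

theorem coeff_single_one_mul (i : Fin 2) (f g : MvPowerSeries (Fin 2) R) :
    coeff (single i 1) (f * g) =
      constantCoeff f * coeff (single i 1) g + coeff (single i 1) f * constantCoeff g := by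
  rw [coeff_mul, antidiagonal_single]
  simp [Finset.Nat.antidiagonal_succ]

theorem sub_mul_divDiff (f : PowerSeries R) :
    (X 0 - X 1) * divDiff f = atU f - atV f := by
  ext e
  have key : ∀ s : Fin 2, coeff e (X s * divDiff f) =
      if 1 ≤ e s then PowerSeries.coeff (e 0 + e 1) f else 0 := by
    intro s
    rw [X, coeff_monomial_mul, one_mul]
    simp only [single_le_iff]
    split_ifs with h
    · change PowerSeries.coeff ((e - single s 1 : Fin 2 →₀ ℕ) 0 + (e - single s 1 : Fin 2 →₀ ℕ) 1 + 1) f = _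
      congr 2
      fin_cases s <;> simp at h ⊢ <;> omega
    · rfl
  have h0 : e = single 0 (e 0) ↔ e 1 = 0 := by
    rw [Finsupp.ext_iff, Fin.forall_fin_two]; simp
  have h1 : e = single 1 (e 1) ↔ e 0 = 0 := by
    rw [Finsupp.ext_iff, Fin.forall_fin_two]; simp
  rw [sub_mul, map_sub, map_sub, key, key, atU, atV, PowerSeries.coeff_subst_single,
    PowerSeries.coeff_subst_single]
  simp only [h0, h1]
  rcases Nat.eq_zero_or_pos (e 0) with a | a <;> rcases Nat.eq_zero_or_pos (e 1) with b | b <;>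
    simp [a, b, Nat.pos_iff_ne_zero.mp, Nat.one_le_iff_ne_zero]

theorem sub_mul_numQuot (A : PowerSeries R) :
    (X 0 - X 1) * numQuot A = X 0 ^ 2 * atV A - X 1 ^ 2 * atU A := by
  have h := sub_mul_divDiff A
  unfold numQuot
  linear_combination (-X 1 ^ 2) * h

theorem sub_mul_denQuot (B : PowerSeries R) :
    (X 0 - X 1) * denQuot B = X 0 * atV B - X 1 * atU B := by
  have h := sub_mul_divDiff B
  unfold denQuot
  linear_combination (-X 1) * h

theorem constantCoeff_denQuot {B : PowerSeries R} (hB : PowerSeries.constantCoeff B = 1) :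
    constantCoeff (denQuot B) = 1 := by
  rw [denQuot, map_sub, constantCoeff_atV, hB]
  simp

/-- `(u B(v) - v B(u)) F(u, v) = u² A(v) - v² A(u)`. -/
theorem mul_buchstaberSeries {A B : PowerSeries R} (hB : PowerSeries.constantCoeff B = 1) :
    (X 0 * atV B - X 1 * atU B) * buchstaberSeries A B = X 0 ^ 2 * atV A - X 1 ^ 2 * atU A := by
  have h := mul_invOfUnit (denQuot B) 1 (by simpa using constantCoeff_denQuot hB)
  rw [← sub_mul_denQuot, ← sub_mul_numQuot, buchstaberSeries]
  linear_combination ((X 0 - X 1) * numQuot A) * h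

theorem buchstaberSeries_zero (A B : PowerSeries R) :
    constantCoeff (buchstaberSeries A B) = 0 := by
  simp [buchstaberSeries, numQuot]

theorem buchstaberSeries_lin {A B : PowerSeries R} (hA : PowerSeries.constantCoeff A = 1)
    (i : Fin 2) : coeff (single i 1) (buchstaberSeries A B) = 1 := by
  have h0 : constantCoeff (numQuot A) = 0 := by simp [numQuot]
  have h1 : coeff (single i 1) (numQuot A) = 1 := by
    rw [numQuot, map_sub, coeff_single_one_mul, coeff_single_one_mul, pow_two,
      coeff_single_one_mul, constantCoeff_atV, hA]
    fin_cases i <;> simp [coeff_index_single_X]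
  rw [buchstaberSeries, coeff_single_one_mul, h0, h1]
  simp

theorem buchstaberSeries_comm [IsDomain R] {A B : PowerSeries R}
    (hB : PowerSeries.constantCoeff B = 1) :
    buchstaberSeries A B = (buchstaberSeries A B).subst
      (![X 1, X 0] : Fin 2 → MvPowerSeries (Fin 2) R) := by
  have hs : HasSubst (![X 1, X 0] : Fin 2 → MvPowerSeries (Fin 2) R) := HasSubst.X_X
  have hU : ∀ f : PowerSeries R, (atU f).subst ![X 1, X 0] = atV f := by
    intro f
    rw [atU, PowerSeries.subst, subst_comp_subst_apply (PowerSeries.HasSubst.X 0).const hs]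
    simp [subst_X hs, atV, PowerSeries.subst]
  have hV : ∀ f : PowerSeries R, (atV f).subst ![X 1, X 0] = atU f := by
    intro f
    rw [atV, PowerSeries.subst, subst_comp_subst_apply (PowerSeries.HasSubst.X 1).const hs]
    simp [subst_X hs, atU, PowerSeries.subst]
  have h := mul_buchstaberSeries (A := A) hB
  have h' := congrArg (subst (![X 1, X 0] : Fin 2 → MvPowerSeries (Fin 2) R)) h
  simp only [subst_mul hs, subst_sub hs, subst_pow hs, subst_X hs, hU, hV] at h'
  simp at h'
  have hne : (X 0 * atV B - X 1 * atU B : MvPowerSeries (Fin 2) R) ≠ 0 := by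
    intro hz
    have := congrArg (coeff (single 0 1)) hz
    rw [map_sub, coeff_single_one_mul, coeff_single_one_mul, constantCoeff_atV, hB] at this
    simp [coeff_index_single_X] at this
  apply mul_left_cancel₀ hne
  linear_combination h + h'

end Quotient

/-- The indeterminates `A_1`, `A_3, A_4, …`, `B_2, B_3, …`, and parameters indexed by `κ`. -/
inductive Var (κ : Type) : Type
  | A1 : Var κ
  /-- the indeterminate `A_{k+3}` -/
  | A (k : ℕ) : Var κ
  /-- the indeterminate `B_{k+2}` -/
  | B (k : ℕ) : Var κ
  | par (p : κ) : Var κ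

/-- `ℤ[A_1, A_3, A_4, …, B_2, B_3, …]` with the parameters adjoined. -/
abbrev Poly (κ : Type) : Type := MvPolynomial (Var κ) ℤ

/-- `A(u) = 1 + A_1 u + A_3 u³ + A_4 u⁴ + …` (so `A_2 = 0`). -/
def univA (κ : Type) : PowerSeries (Poly κ) :=
  PowerSeries.mk fun n => match n with
    | 0 => 1
    | 1 => MvPolynomial.X Var.A1
    | 2 => 0
    | k + 3 => MvPolynomial.X (Var.A k)

/-- `B(u) = 1 + B_2 u² + B_3 u³ + …` (so `B_1 = 0`). -/
def univB (κ : Type) : PowerSeries (Poly κ) :=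
  PowerSeries.mk fun n => match n with
    | 0 => 1
    | 1 => 0
    | k + 2 => MvPolynomial.X (Var.B k)

/-- The constant series given by a parameter. -/
def param {κ : Type} (p : κ) : PowerSeries (Poly κ) :=
  PowerSeries.C (MvPolynomial.X (Var.par p))

/-- `F(u, v) = (u² A(v) - v² A(u)) / (u B(v) - v B(u))` with indeterminate coefficients. -/
def univF (κ : Type) : MvPowerSeries (Fin 2) (Poly κ) := buchstaberSeries (univA κ) (univB κ)

/-- `F(F(u, v), w)`. -/
def assLeft (κ : Type) : MvPowerSeries (Fin 3) (Poly κ) :=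
  (univF κ).subst
    (![(univF κ).subst (![X 0, X 1] : Fin 2 → MvPowerSeries (Fin 3) (Poly κ)), X 2] :
      Fin 2 → MvPowerSeries (Fin 3) (Poly κ))

/-- `F(u, F(v, w))`. -/
def assRight (κ : Type) : MvPowerSeries (Fin 3) (Poly κ) :=
  (univF κ).subst
    (![X 0, (univF κ).subst (![X 1, X 2] : Fin 2 → MvPowerSeries (Fin 3) (Poly κ))] :
      Fin 2 → MvPowerSeries (Fin 3) (Poly κ))

/-- The associativity ideal, generated by all coefficients of `F(F(u, v), w) - F(u, F(v, w))`. -/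
def assIdeal (κ : Type) : Ideal (Poly κ) :=
  Ideal.span (Set.range fun e => coeff e (assLeft κ - assRight κ))

/-- The ideal generated by a relation `l = r` between power series: it is generated by all
coefficients of `l - r`. -/
def relIdeal {κ : Type} (l r : PowerSeries (Poly κ)) : Ideal (Poly κ) :=
  Ideal.span (Set.range fun n => PowerSeries.coeff n (l - r))

/-- The coefficient ring of the universal formal group of Buchstaber form that satisfies `l = r`. -/
abbrev UnivRing {κ : Type} (l r : PowerSeries (Poly κ)) : Type :=
  Poly κ ⧸ (assIdeal κ ⊔ relIdeal l r)

/-- The universal formal group of Buchstaber form that satisfies the relation `l = r`. -/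
def univGroup {κ : Type} (l r : PowerSeries (Poly κ)) : FormalGroup (UnivRing l r) where
  toPowerSeries := (univF κ).map (Ideal.Quotient.mk (assIdeal κ ⊔ relIdeal l r))
  zero_constantCoeff := by
    rw [constantCoeff_map, univF, buchstaberSeries_zero, map_zero]
  lin_coeff_X := by
    rw [coeff_map, univF, buchstaberSeries_lin (by simp [univA]), map_one]
  lin_coeff_Y := by
    rw [coeff_map, univF, buchstaberSeries_lin (by simp [univA]), map_one]
  assoc := by
    have hF : constantCoeff (univF κ) = 0 := buchstaberSeries_zero _ _
    set q := Ideal.Quotient.mk (assIdeal κ ⊔ relIdeal l r) with hq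
    have hass : (assLeft κ).map q = (assRight κ).map q := by
      ext e
      rw [coeff_map, coeff_map, hq, Ideal.Quotient.eq, ← map_sub]
      exact Ideal.mem_sup_left (Ideal.subset_span ⟨e, rfl⟩)
    have hv (g₁ g₂ : MvPowerSeries (Fin 3) (Poly κ)) :
        (fun i => (![g₁, g₂] i).map q) = ![g₁.map q, g₂.map q] := by
      ext1 i; fin_cases i <;> simp
    rw [assLeft, assRight, map_subst (HasSubst.cons_subst_zero_left 0 1 2 hF),
      map_subst (HasSubst.cons_subst_zero_right 0 1 2 hF), hv, hv, map_subst HasSubst.X_X,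
      map_subst HasSubst.X_X, hv, hv] at hass
    simpa only [map_X] using hass

/-- The formal groups considered here are commutative. -/
instance univGroup_isComm {κ : Type} (l r : PowerSeries (Poly κ)) : (univGroup l r).IsComm where
  comm := by
    have h := buchstaberSeries_comm (A := univA κ) (B := univB κ) (by simp [univB])
    have h' := congrArg (MvPowerSeries.map (Ideal.Quotient.mk (assIdeal κ ⊔ relIdeal l r))) h
    rw [map_subst HasSubst.X_X] at h'
    have hv : (fun i => ((![X 1, X 0] : Fin 2 → MvPowerSeries (Fin 2) (Poly κ)) i).map
        (Ideal.Quotient.mk (assIdeal κ ⊔ relIdeal l r))) = ![X 1, X 0] := by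
      ext1 i; fin_cases i <;> simp
    rw [hv] at h'
    exact h'

/-- A formal group `F = u + v + ∑_{i,j ≥ 1} a_{i,j} u^i v^j` over `R` is generating if its ring of
coefficients, that is the subring of `R` generated by the `a_{i,j}`, is all of `R`. -/
def IsGenerating {R : Type*} [CommRing R] (F : FormalGroup R) : Prop :=
  Subring.closure {a : R | ∃ i j : ℕ, 1 ≤ i ∧ 1 ≤ j ∧
    a = coeff (single 0 i + single 1 j) F.toPowerSeries} = ⊤

/-- The parameters `a_1, b_1, b_2`. -/
inductive Par5 : Type
  | a1 | b1 | b2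

/-- `(B(u) + b_1 u)² (B(u) + b_2 u)`. -/
def lhs5 : PowerSeries (Poly Par5) :=
  (univB Par5 + param .b1 * PowerSeries.X) ^ 2 * (univB Par5 + param .b2 * PowerSeries.X)

/-- `A(u)² (A(u) + a_1 u²)²`. -/
def rhs5 : PowerSeries (Poly Par5) :=
  univA Par5 ^ 2 * (univA Par5 + param .a1 * PowerSeries.X ^ 2) ^ 2

/-- The ring `R_5`. -/
abbrev R5 : Type := UnivRing lhs5 rhs5

/-- The universal formal group over `R_5`. -/
def F5 : FormalGroup R5 := univGroup lhs5 rhs5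

/-- The parameters `a_1, a_2, b_1, b_2`. -/
inductive Par6 : Type
  | a1 | a2 | b1 | b2

/-- `(B(u) + b_1 u)² (B(u) + b_2 u)²`. -/
def lhs6 : PowerSeries (Poly Par6) :=
  (univB Par6 + param .b1 * PowerSeries.X) ^ 2 * (univB Par6 + param .b2 * PowerSeries.X) ^ 2

/-- `A(u)² (A(u) + a_1 u²)² (A(u) + a_2 u²)`. -/
def rhs6 : PowerSeries (Poly Par6) :=
  univA Par6 ^ 2 * (univA Par6 + param .a1 * PowerSeries.X ^ 2) ^ 2 *
    (univA Par6 + param .a2 * PowerSeries.X ^ 2)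

/-- The ring `R_6`. -/
abbrev R6 : Type := UnivRing lhs6 rhs6

/-- The universal formal group over `R_6`. -/
def F6 : FormalGroup R6 := univGroup lhs6 rhs6

end BuchstaberFG

end

noncomputable section

namespace BuchstaberFG

open MvPowerSeries Finsupp

section Specialization

variable {κ : Type} {S : Type*} [CommRing S]

/-! The parameters enter only through the relation, so it suffices to find a quotient in which `F`
loses all information while a parameter survives. Setting `A = B = 1` turns `F` into the additive
law `u + v`, which is associative and has coefficients 0 and 1. With all `b_i = 0` (and `a_2 = 0` in
the second case) the relation reduces to `(1 + a_1 u²)² = 1`, that is, `2 a_1 = 0` and `a_1² = 0`.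
This has the nonzero solution `a_1 = ε` in the dual numbers over `ZMod 2`.

The resulting homomorphism descends to the quotient ring (`specialize_eq_zero_of_mem`). It sends the
ring of coefficients of `F` into the image of `ℤ`, but `a_1` to `ε`, which is not an integer. Hence
`a_1` lies outside the ring of coefficients (`not_isGenerating_univGroup`). -/

/-- The specialization `A(u) = B(u) = 1` with prescribed values of the parameters. -/
def specialize (c : κ → S) : Poly κ →+* S :=
  MvPolynomial.eval₂Hom (Int.castRingHom S) fun
    | .A1 => 0
    | .A _ => 0
    | .B _ => 0
    | .par p => c p

theorem map_atV {R : Type*} [CommRing R] (φ : R →+* S) (f : PowerSeries R) :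
    (atV f).map φ = atV (f.map φ) := by
  ext e
  rw [coeff_map, atV, atV, PowerSeries.coeff_subst_single, PowerSeries.coeff_subst_single]
  split_ifs <;> simp

theorem map_divDiff {R : Type*} [CommRing R] (φ : R →+* S) (f : PowerSeries R) :
    (divDiff f).map φ = divDiff (f.map φ) := by
  ext e
  rw [coeff_map]
  exact (PowerSeries.coeff_map φ _ f).symm

theorem divDiff_one : divDiff (1 : PowerSeries S) = 0 := by
  ext e
  change PowerSeries.coeff (e 0 + e 1 + 1) (1 : PowerSeries S) = 0
  simp [PowerSeries.coeff_one]

theorem atV_one : atV (1 : PowerSeries S) = 1 := by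
  rw [atV, ← PowerSeries.coe_substAlgHom (PowerSeries.HasSubst.X 1), map_one]

theorem map_univA_specialize (c : κ → S) : (univA κ).map (specialize c) = 1 := by
  ext n
  rw [PowerSeries.coeff_map, univA, PowerSeries.coeff_mk, PowerSeries.coeff_one]
  rcases n with _ | _ | _ | n <;> simp [specialize]

theorem map_univB_specialize (c : κ → S) : (univB κ).map (specialize c) = 1 := by
  ext n
  rw [PowerSeries.coeff_map, univB, PowerSeries.coeff_mk, PowerSeries.coeff_one]
  rcases n with _ | _ | n <;> simp [specialize]

theorem specialize_par (c : κ → S) (p : κ) :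
    specialize c (MvPolynomial.X (Var.par p)) = c p := by
  simp [specialize]

theorem map_param_specialize (c : κ → S) (p : κ) :
    (param p).map (specialize c) = PowerSeries.C (c p) := by
  rw [param, PowerSeries.map_C, specialize_par]

/-- The specialized group is the additive group. -/
theorem map_univF_specialize (c : κ → S) : (univF κ).map (specialize c) = X 0 + X 1 := by
  have hnum : (numQuot (univA κ)).map (specialize c) = X 0 + X 1 := by
    simp [numQuot, map_atV, map_divDiff, map_univA_specialize, divDiff_one, atV_one]
  have hden : (denQuot (univB κ)).map (specialize c) = 1 := by
    simp [denQuot, map_atV, map_divDiff, map_univB_specialize, divDiff_one, atV_one]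
  -- The inverse is known only through its defining product, so that identity is mapped; the
  -- denominator becomes 1, and hence so does its inverse.
  have hinv := congrArg (MvPowerSeries.map (specialize c)) <|
    mul_invOfUnit (denQuot (univB κ)) 1
      (by simpa using constantCoeff_denQuot (B := univB κ) (by simp [univB]))
  rw [map_mul, hden, one_mul, map_one] at hinv
  rw [univF, buchstaberSeries, map_mul, hnum, hinv, mul_one]

/-- Coefficient maps commute with substitution of series without constant term, so both sides become
iterated sums, equal by associativity of addition. -/
theorem map_assLeft_eq_map_assRight (c : κ → S) :
    (assLeft κ).map (specialize c) = (assRight κ).map (specialize c) := by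
  have hF : constantCoeff (univF κ) = 0 := buchstaberSeries_zero _ _
  have hG : constantCoeff (X 0 + X 1 : MvPowerSeries (Fin 2) S) = 0 := by simp
  have hv (g₁ g₂ : MvPowerSeries (Fin 3) (Poly κ)) :
      (fun i => (![g₁, g₂] i).map (specialize c)) =
        ![g₁.map (specialize c), g₂.map (specialize c)] := by
    ext1 i; fin_cases i <;> simp
  rw [assLeft, assRight, map_subst (HasSubst.cons_subst_zero_left 0 1 2 hF),
    map_subst (HasSubst.cons_subst_zero_right 0 1 2 hF), hv, hv, map_subst HasSubst.X_X,
    map_subst HasSubst.X_X, hv, hv]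
  simp only [map_X, map_univF_specialize]
  rw [subst_add (HasSubst.cons_subst_zero_left 0 1 2 hG),
    subst_add (HasSubst.cons_subst_zero_right 0 1 2 hG),
    subst_X (HasSubst.cons_subst_zero_left 0 1 2 hG),
    subst_X (HasSubst.cons_subst_zero_right 0 1 2 hG),
    subst_X (HasSubst.cons_subst_zero_left 0 1 2 hG),
    subst_X (HasSubst.cons_subst_zero_right 0 1 2 hG)]
  simp [subst_add HasSubst.X_X, subst_X HasSubst.X_X, add_assoc]

theorem specialize_eq_zero_of_mem (c : κ → S) {l r : PowerSeries (Poly κ)}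
    (h : l.map (specialize c) = r.map (specialize c)) :
    ∀ x ∈ assIdeal κ ⊔ relIdeal l r, specialize c x = 0 := by
  suffices assIdeal κ ⊔ relIdeal l r ≤ RingHom.ker (specialize c) from fun x hx => this hx
  refine sup_le (Ideal.span_le.2 ?_) (Ideal.span_le.2 ?_)
  · rintro _ ⟨e, rfl⟩
    rw [SetLike.mem_coe, RingHom.mem_ker, ← coeff_map, map_sub, map_assLeft_eq_map_assRight,
      sub_self, map_zero]
  · rintro _ ⟨n, rfl⟩
    rw [SetLike.mem_coe, RingHom.mem_ker, ← PowerSeries.coeff_map, map_sub, h, sub_self, map_zero]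

/-- If the relation `l = r` holds for `A = B = 1` and the parameter values `c` in `S`, and one of
these values is not an integer multiple of `1`, then the universal group is not generating. -/
theorem not_isGenerating_univGroup (c : κ → S) {l r : PowerSeries (Poly κ)}
    (h : l.map (specialize c) = r.map (specialize c)) (p : κ)
    (hp : c p ∉ (Int.castRingHom S).range) : ¬ IsGenerating (univGroup l r) := by
  intro hgen
  let φ : UnivRing l r →+* S :=
    Ideal.Quotient.lift _ (specialize c) (specialize_eq_zero_of_mem c h)
  -- The preimage of the integers is a subring containing every coefficient of the group law; if
  -- these generate, it is everything.
  have hle : (⊤ : Subring (UnivRing l r)) ≤ (Int.castRingHom S).range.comap φ := by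
    rw [← hgen, Subring.closure_le]
    rintro _ ⟨i, j, -, -, rfl⟩
    rw [SetLike.mem_coe, Subring.mem_comap, univGroup, coeff_map, Ideal.Quotient.lift_mk,
      ← coeff_map, map_univF_specialize, map_add, coeff_X, coeff_X]
    -- Each coefficient of `X 0` and of `X 1` is 0 or 1.
    refine add_mem ?_ ?_ <;> split_ifs <;> first | exact one_mem _ | exact zero_mem _
  apply hp
  have := hle (Subring.mem_top (Ideal.Quotient.mk _ (MvPolynomial.X (Var.par p))))
  rwa [Subring.mem_comap, Ideal.Quotient.lift_mk, specialize_par] at this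

end Specialization

/-- Integers have zero `ε`-component. -/
theorem eps_notMem_range_intCast :
    (DualNumber.eps : DualNumber (ZMod 2)) ∉ (Int.castRingHom (DualNumber (ZMod 2))).range := by
  rintro ⟨n, hn⟩
  simpa using congrArg TrivSqZeroExt.snd hn

/-- The cross term `2εX²` vanishes in characteristic 2, and the `X⁴` term because `ε² = 0`. -/
theorem one_add_eps_mul_X_sq_sq :
    (1 + PowerSeries.C (DualNumber.eps : DualNumber (ZMod 2)) * PowerSeries.X ^ 2) ^ 2 = 1 := by
  have h2 : (2 : DualNumber (ZMod 2)) = 0 := by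
    have := congrArg (algebraMap (ZMod 2) (DualNumber (ZMod 2))) (show (2 : ZMod 2) = 0 from rfl)
    simpa only [map_ofNat, map_zero] using this
  have h2' : (2 : PowerSeries (DualNumber (ZMod 2))) = 0 := by
    have := congrArg (PowerSeries.C (R := DualNumber (ZMod 2))) h2
    simpa only [map_ofNat, map_zero] using this
  have he : PowerSeries.C (DualNumber.eps : DualNumber (ZMod 2)) * PowerSeries.C DualNumber.eps
      = 0 := by
    rw [← map_mul, DualNumber.eps_mul_eps, map_zero]
  linear_combination PowerSeries.X ^ 4 * he +
    PowerSeries.C (DualNumber.eps : DualNumber (ZMod 2)) * PowerSeries.X ^ 2 * h2'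

theorem not_isGenerating_F5 : ¬ IsGenerating F5 := by
  let c : Par5 → DualNumber (ZMod 2)
    | .a1 => DualNumber.eps
    | .b1 => 0
    | .b2 => 0
  refine not_isGenerating_univGroup c ?_ .a1 eps_notMem_range_intCast
  simp [lhs5, rhs5, map_univA_specialize, map_univB_specialize, map_param_specialize, c,
    one_add_eps_mul_X_sq_sq]

theorem not_isGenerating_F6 : ¬ IsGenerating F6 := by
  let c : Par6 → DualNumber (ZMod 2)
    | .a1 => DualNumber.eps
    -- The factor containing `a_2` is not squared; once the other factors are 1, it must itself be
    -- 1.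
    | .a2 => 0
    | .b1 => 0
    | .b2 => 0
  refine not_isGenerating_univGroup c ?_ .a1 eps_notMem_range_intCast
  simp [lhs6, rhs6, map_univA_specialize, map_univB_specialize, map_param_specialize, c,
    one_add_eps_mul_X_sq_sq]

end BuchstaberFG

end

theorem mainTheorem6 :
    ¬ BuchstaberFG.IsGenerating BuchstaberFG.F5 ∧
      ¬ BuchstaberFG.IsGenerating BuchstaberFG.F6 :=
  ⟨BuchstaberFG.not_isGenerating_F5, BuchstaberFG.not_isGenerating_F6⟩
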